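/- Let $\Xi\subseteq\mathbb R^d$ be closed and convex, let $\mathcal P(S)$ denote the set of Borel probability measures on $S$, let $\mathbb P_1,\dots,\mathbb P_K\in\mathcal P(\Xi)$ and $\lambda_1,\dots,\lambda_K\ge 0$. Let $c:\Xi\times\Xi\to[0,\infty)$ be lower semicontinuous with $c(\xi,\xi')=0$ if and only if $\xi=\xi'$, and suppose that there are an integer $p\ge 1$ and a metric $\rho$ on $\Xi$ whose sublevel sets $\{\xi\in\Xi:\rho(\xi,\xi')\le r\}$, $\xi'\in\Xi$, $r\in\mathbb R$, are compact (in the Euclidean topology) such that $c\ge\rho^p$. Suppose also that some $\xi_0\in\Xi$ satisfies $\int_\Xi c(\xi_0,\xi)\,\mathrm d\mathbb P_k(\xi)<\infty$ for all $k$. For $\mathbb P,\mathbb Q\in\mathcal P(\Xi)$ let $C(\mathbb P,\mathbb Q)\in[0,\infty]$ be the infimum of $\int_{\Xi^2} c\,\mathrm d\pi$ over all couplings $\pi$ of $\mathbb P$ and $\mathbb Q$. An OT barycenter is a minimizer of $\sum_{k=1}^K\lambda_k C(\mathbb P,\mathbb P_k)$ over $\mathbb P\in\mathcal P(\Xi)$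 (with $0\cdot\infty=0$). Let $\Pi(\mathbb P_1,\dots,\mathbb P_K)$ be the set of all $\pi\in\mathcal P(\Xi^K)$ with marginals $\mathbb P_1,\dots,\mathbb P_K$. Let $$\phi(\xi_1,\dots,\xi_K)=\inf_{\xi\in\Xi}\sum_{k=1}^K\lambda_k c(\xi,\xi_k),$$ and call a Borel map $\Phi:\Xi^K\to\Xi$ a measurable selector if $\Phi(\xi_1,\dots,\xi_K)$ attains this infimum for all $(\xi_1,\dots,\xi_K)\in\Xi^K$. Then $\phi$ is Borel measurable, a measurable selector exists, and the multi-margin OT problem $$\min_{\pi\in\Pi(\mathbb P_1,\dots,\mathbb P_K)}\int_{\Xi^K}\phi\,\mathrm d\pi$$ has an optimal solution. For every measurable selector $\Phi$ and every optimal solution $\pi^\star$ of this problem, the pushforward $\Phi_\#\pi^\star$ is an OT barycenter of $\mathbb P_1,\dots,\mathbb P_K$; in particular, an OT barycenter of this form exists. If the measurable selector $\Phi$ is unique, then every OT barycenter equals $\Phi_\#\pi^\star$ for some optimal solution $\pi^\star$. -/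

import Mathlib

open MeasureTheory
open scoped NNReal ENNReal

noncomputable section

/-- `d` is a metric on the set `X` (with no relation to a topology of `X` imposed). -/
structure IsMetricFun {X : Type*} (d : X → X → ℝ) : Prop where
  nonneg : ∀ x y, 0 ≤ d x y
  eq_zero_iff : ∀ x y, d x y = 0 ↔ x = y
  symm : ∀ x y, d x y = d y x
  triangle : ∀ x y z, d x z ≤ d x y + d y z

/-- The standing assumption on the transportation cost function `c`: lower semicontinuity, the
identity of indiscernibles, and a lower bound by the `p`-th power (`p ≥ 1`) of some metric whose
sublevel sets `{x | d x x₀ ≤ r}` are compact in the topology of `X`. -/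
structure IsTransportCost {X : Type*} [TopologicalSpace X] (c : X → X → ℝ≥0) : Prop where
  lowerSemicontinuous : LowerSemicontinuous (fun z : X × X => c z.1 z.2)
  eq_zero_iff : ∀ x y, c x y = 0 ↔ x = y
  exists_metric : ∃ d : X → X → ℝ, IsMetricFun d ∧
    (∀ (x₀ : X) (r : ℝ), IsCompact {x | d x x₀ ≤ r}) ∧
    ∃ p : ℕ, 1 ≤ p ∧ ∀ x y, d x y ^ p ≤ (c x y : ℝ)

variable {X : Type*} [MeasurableSpace X]

/-- Transportation plans (couplings) between `P` and `Q`. -/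
def transportPlans (P Q : ProbabilityMeasure X) : Set (ProbabilityMeasure (X × X)) :=
  {π | (π : Measure (X × X)).map Prod.fst = (P : Measure X) ∧
    (π : Measure (X × X)).map Prod.snd = (Q : Measure X)}

/-- Multi-margin transportation plans: probability measures on `X ^ K` with marginals
`P 0, …, P (K - 1)`. -/
def multiMarginPlans {K : ℕ} (P : Fin K → ProbabilityMeasure X) :
    Set (ProbabilityMeasure (Fin K → X)) :=
  {π | ∀ k, (π : Measure (Fin K → X)).map (fun x => x k) = (P k : Measure X)}

/-- The optimal transport cost, with values in `[0, ∞]`. -/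
def otCost (c : X → X → ℝ≥0) (P Q : ProbabilityMeasure X) : ℝ≥0∞ :=
  ⨅ π ∈ transportPlans P Q, ∫⁻ z, (c z.1 z.2 : ℝ≥0∞) ∂(π : Measure (X × X))

/-- The objective function of the barycenter problem (with the convention `0 * ∞ = 0`). -/
def barycenterObjective {K : ℕ} (c : X → X → ℝ≥0) (lam : Fin K → ℝ≥0)
    (P : Fin K → ProbabilityMeasure X) (Q : ProbabilityMeasure X) : ℝ≥0∞ :=
  ∑ k, (lam k : ℝ≥0∞) * otCost c Q (P k)

/-- `Q` is an OT barycenter of `P` with weights `lam`. -/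
def IsOTBarycenter {K : ℕ} (c : X → X → ℝ≥0) (lam : Fin K → ℝ≥0)
    (P : Fin K → ProbabilityMeasure X) (Q : ProbabilityMeasure X) : Prop :=
  ∀ Q' : ProbabilityMeasure X, barycenterObjective c lam P Q ≤ barycenterObjective c lam P Q'

/-- The objective function of the pointwise problem `min_ξ ∑ k, λ_k c(ξ, ξ_k)`. -/
def pointObjective {X : Type*} {K : ℕ} (c : X → X → ℝ≥0) (lam : Fin K → ℝ≥0)
    (x : Fin K → X) (ξ : X) : ℝ≥0 :=
  ∑ k, lam k * c ξ (x k)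

/-- The optimal value function `φ : X ^ K → [0, ∞]` of the pointwise problem. -/
def pointValue {X : Type*} {K : ℕ} (c : X → X → ℝ≥0) (lam : Fin K → ℝ≥0)
    (x : Fin K → X) : ℝ≥0∞ :=
  ⨅ ξ : X, (pointObjective c lam x ξ : ℝ≥0∞)

/-- `Φ` is a measurable selector of the solution map of the pointwise problem. -/
def IsMeasurableSelector {K : ℕ} (c : X → X → ℝ≥0) (lam : Fin K → ℝ≥0)
    (Φ : (Fin K → X) → X) : Prop :=
  Measurable Φ ∧ ∀ x ξ, pointObjective c lam x (Φ x) ≤ pointObjective c lam x ξ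

/-- `π` is an optimal solution of the multi-margin OT problem with cost `φ`. -/
def IsOptimalMultiMarginPlan {K : ℕ} (c : X → X → ℝ≥0) (lam : Fin K → ℝ≥0)
    (P : Fin K → ProbabilityMeasure X) (π : ProbabilityMeasure (Fin K → X)) : Prop :=
  π ∈ multiMarginPlans P ∧ ∀ π' ∈ multiMarginPlans P,
    ∫⁻ x, pointValue c lam x ∂(π : Measure (Fin K → X)) ≤
      ∫⁻ x, pointValue c lam x ∂(π' : Measure (Fin K → X))

end

/-! Both problems minimize the integral of `∑ λ_k c(ξ, ξ_k)` over joint laws `γ` of `(ξ, ξ_1, …,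
ξ_K)` in which each `ξ_k` has law `P_k`. If the law `Q` of `ξ` is prescribed, the minimum is the
barycenter objective at `Q`, because optimal plans between `Q` and the `P_k` can be glued along `Q`
(`exists_gluing`). If instead the law `π` of `(ξ_1, …, ξ_K)` is prescribed, the minimum is `∫ φ dπ`,
attained by `ξ = Φ(ξ_1, …, ξ_K)`. The two optimal values therefore agree, and `Φ` pushes an optimal
`π` to a barycenter.

Conversely, the glued law of a barycenter is optimal among all `γ`. Its cost is finite, so `ξ`
minimizes the pointwise objective almost surely. A unique selector forces unique pointwise
minimizers, hence `ξ = Φ(ξ_1, …, ξ_K)` almost surely.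

For existence, the direct method is run on `γ`, whose integrand is lower semicontinuous, rather than
on `π`; the law of `ξ` is kept tight by the compact `ρ`-balls and a cost bound. The selector comes
from compactness of the sets of minimizers (`exists_measurable_selection`). -/

open Filter Topology Set

/-! ### Weak lower semicontinuity, tightness and the direct method -/

section Minimization

variable {E : Type*} [TopologicalSpace E] [MeasurableSpace E] [BorelSpace E]

theorem isClosed_setOf_map_eq {F : Type*} [TopologicalSpace F] [PolishSpace F] [MeasurableSpace F]
    [BorelSpace F] {g : E → F} (hg : Continuous g) (ν : ProbabilityMeasure F) :
    IsClosed {μ : ProbabilityMeasure E | (μ : Measure E).map g = (ν : Measure F)} := by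
  have h : IsClosed {μ : ProbabilityMeasure E | μ.map hg.measurable.aemeasurable = ν} :=
    isClosed_eq (ProbabilityMeasure.continuous_map hg) continuous_const
  convert h using 3 with μ
  exact (Subtype.ext_iff (a1 := μ.map hg.measurable.aemeasurable) (a2 := ν)).symm
variable [PolishSpace E]

/-- By the layer-cake formula the integral is `∫ μ {f > t} dt`. The superlevel sets are open, so the
portmanteau theorem and Fatou's lemma apply, with no bound on `f`. -/
theorem lowerSemicontinuous_lintegral {f : E → ℝ≥0} (hf : LowerSemicontinuous f) :
    LowerSemicontinuous fun μ : ProbabilityMeasure E => ∫⁻ x, (f x : ℝ≥0∞) ∂(μ : Measure E) := by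
  rw [lowerSemicontinuous_iff_isClosed_preimage]
  intro a
  apply IsSeqClosed.isClosed
  intro μs μ hle hlim
  have hopen (G : Set E) (hG : IsOpen G) :
      (μ : Measure E) G ≤ atTop.liminf fun i => (μs i : Measure E) G :=
    ProbabilityMeasure.le_liminf_measure_open_of_tendsto hlim hG
  have layer (ν : ProbabilityMeasure E) : ∫⁻ x, (f x : ℝ≥0∞) ∂(ν : Measure E) =
      ∫⁻ t in Ioi (0 : ℝ), (ν : Measure E) {x | t < f x} := by
    rw [← lintegral_eq_lintegral_meas_lt (ν : Measure E) (f := fun x => (f x : ℝ))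
      (Eventually.of_forall fun x => (f x).coe_nonneg) (by have := hf.measurable; fun_prop)]
    simp
  have hG (t : ℝ) : IsOpen {x | t < (f x : ℝ)} := by
    rcases lt_or_ge t 0 with ht | ht
    · convert isOpen_univ
      exact eq_univ_of_forall fun x => ht.trans_le (f x).coe_nonneg
    · lift t to ℝ≥0 using ht
      simp only [NNReal.coe_lt_coe]
      exact hf.isOpen_preimage t
  have hle' : ∀ i, ∫⁻ x, (f x : ℝ≥0∞) ∂(μs i : Measure E) ≤ a := hle
  change ∫⁻ x, (f x : ℝ≥0∞) ∂(μ : Measure E) ≤ a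
  calc ∫⁻ x, (f x : ℝ≥0∞) ∂(μ : Measure E)
      ≤ ∫⁻ t in Ioi (0 : ℝ), atTop.liminf fun i => (μs i : Measure E) {x | t < f x} := by
        rw [layer]
        exact lintegral_mono fun t => hopen _ (hG t)
    _ ≤ atTop.liminf fun i => ∫⁻ t in Ioi (0 : ℝ), (μs i : Measure E) {x | t < f x} :=
        lintegral_liminf_le fun n => Antitone.measurable fun s t hst =>
          measure_mono fun x hx => lt_of_le_of_lt hst hx
    _ ≤ a := by
        simp_rw [← layer]
        refine liminf_le_of_frequently_le' (Frequently.of_forall hle')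

theorem exists_lintegral_le_of_isTightMeasureSet {f : E → ℝ≥0} (hf : LowerSemicontinuous f)
    {S : Set (ProbabilityMeasure E)} (hclosed : IsClosed S) (hne : S.Nonempty)
    (htight : IsTightMeasureSet {((μ : ProbabilityMeasure E) : Measure E) | μ ∈ S}) :
    ∃ μ ∈ S, ∀ ν ∈ S, ∫⁻ x, (f x : ℝ≥0∞) ∂(μ : Measure E) ≤
      ∫⁻ x, (f x : ℝ≥0∞) ∂(ν : Measure E) := by
  have hcomp := isCompact_closure_of_isTightMeasureSet htight
  rw [hclosed.closure_eq] at hcomp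
  obtain ⟨μ, hμ, hmin⟩ := LowerSemicontinuousOn.exists_isMinOn hne hcomp
    ((lowerSemicontinuous_lintegral hf).lowerSemicontinuousOn S)
  exact ⟨μ, hμ, fun ν hν => hmin hν⟩

theorem isTightMeasureSet_pi {ι : Type*} [Fintype ι] {S : Set (Measure (ι → E))}
    (hS : ∀ i, IsTightMeasureSet (Measure.map (fun x : ι → E => x i) '' S)) :
    IsTightMeasureSet S := by
  simp only [isTightMeasureSet_iff_exists_isCompact_measure_compl_le] at hS ⊢
  intro ε hε
  choose C hC hCS using fun i => hS i (ε / (Fintype.card ι + 1))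
    (ENNReal.div_pos hε.ne' (by finiteness))
  refine ⟨univ.pi C, isCompact_univ_pi hC, fun μ hμ => ?_⟩
  calc μ (univ.pi C)ᶜ ≤ μ (⋃ i, (fun x : ι → E => x i) ⁻¹' (C i)ᶜ) := by
        gcongr
        intro x hx
        simpa using hx
    _ ≤ ∑ i, μ ((fun x : ι → E => x i) ⁻¹' (C i)ᶜ) := measure_iUnion_fintype_le _ _
    _ ≤ ∑ _i : ι, ε / (Fintype.card ι + 1) := by
        gcongr with i
        rw [← Measure.map_apply (by fun_prop) (hC i).isClosed.measurableSet.compl]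
        exact hCS i _ (mem_image_of_mem _ hμ)
    _ = Fintype.card ι * (ε / (Fintype.card ι + 1)) := by simp
    _ ≤ (Fintype.card ι + 1) * (ε / (Fintype.card ι + 1)) := by gcongr; exact le_self_add
    _ ≤ ε := ENNReal.mul_div_le

end Minimization

/-! ### Optimal couplings and gluing -/

section Transport

variable {X : Type*} [TopologicalSpace X] [PolishSpace X] [MeasurableSpace X] [BorelSpace X]

theorem exists_otCost_eq_lintegral {c : X → X → ℝ≥0}
    (hc : LowerSemicontinuous fun z : X × X => c z.1 z.2) (P Q : ProbabilityMeasure X) :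
    ∃ π ∈ transportPlans P Q,
      otCost c P Q = ∫⁻ z, (c z.1 z.2 : ℝ≥0∞) ∂(π : Measure (X × X)) := by
  have hclosed : IsClosed (transportPlans P Q) :=
    (isClosed_setOf_map_eq continuous_fst P).inter (isClosed_setOf_map_eq continuous_snd Q)
  have hne : (transportPlans P Q).Nonempty := ⟨P.prod Q, by simp [transportPlans]⟩
  have htight : IsTightMeasureSet
      {((μ : ProbabilityMeasure (X × X)) : Measure (X × X)) | μ ∈ transportPlans P Q} := by
    apply IsTightMeasureSet.prodMk
    · refine (isTightMeasureSet_singleton (μ := (P : Measure X))).subset ?_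
      rintro _ ⟨_, ⟨μ, hμ, rfl⟩, rfl⟩
      exact hμ.1
    · refine (isTightMeasureSet_singleton (μ := (Q : Measure X))).subset ?_
      rintro _ ⟨_, ⟨μ, hμ, rfl⟩, rfl⟩
      exact hμ.2
  obtain ⟨π, hπ, hmin⟩ := exists_lintegral_le_of_isTightMeasureSet hc hclosed hne htight
  exact ⟨π, hπ, le_antisymm (iInf₂_le π hπ) (le_iInf₂ hmin)⟩

/-- Disintegrate every plan over the common marginal `Q` and make the second coordinates
conditionally independent given the first. -/
theorem exists_gluing {K : ℕ} (Q : ProbabilityMeasure X)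
    (π : Fin K → ProbabilityMeasure (X × X))
    (hπ : ∀ k, (π k : Measure (X × X)).map Prod.fst = (Q : Measure X)) :
    ∃ γ : ProbabilityMeasure (X × (Fin K → X)),
      (γ : Measure (X × (Fin K → X))).map Prod.fst = (Q : Measure X) ∧
      ∀ k, (γ : Measure (X × (Fin K → X))).map (fun z => (z.1, z.2 k)) =
        (π k : Measure (X × X)) := by
  have : Nonempty X := Q.nonempty
  let κ (k : Fin K) : ProbabilityTheory.Kernel X X := (π k : Measure (X × X)).condKernel
  have hmeas : Measurable fun x => Measure.pi fun k => κ k x := by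
    -- It is enough to test on boxes, whose mass is a finite product of measurable functions.
    refine Measurable.measure_of_isPiSystem_of_isProbabilityMeasure generateFrom_pi.symm
      isPiSystem_pi ?_
    rintro _ ⟨s, hs, rfl⟩
    simp only [Measure.pi_pi]
    exact Finset.measurable_prod _ fun k _ =>
      (κ k).measurable_coe (hs k (mem_univ k))
  let η : ProbabilityTheory.Kernel X (Fin K → X) := ⟨fun x => Measure.pi fun k => κ k x, hmeas⟩
  have : ProbabilityTheory.IsMarkovKernel η := ⟨fun x => by
    change IsProbabilityMeasure (Measure.pi fun k => κ k x); infer_instance⟩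
  refine ⟨⟨(Q : Measure X).compProd η, inferInstance⟩, ?_, fun k => ?_⟩
  · exact Measure.fst_compProd _ _
  · have hη : η.map (fun x : Fin K → X => x k) = κ k := by
      ext1 x
      rw [ProbabilityTheory.Kernel.map_apply _ (by fun_prop)]
      exact (measurePreserving_eval (fun k => κ k x) k).map_eq
    have h := Measure.compProd_map (μ := (Q : Measure X)) (κ := η)
      (measurable_pi_apply k)
    rw [hη] at h
    change ((Q : Measure X).compProd η).map (Prod.map id fun x : Fin K → X => x k) = _
    rw [← h, ← hπ k]
    exact (π k : Measure (X × X)).disintegrate _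

end Transport

/-! ### Measurable infima and measurable selection -/

section Selection

/-- The infimum is below `a` exactly when some sublevel set at a level `q < a`, `q` rational, has a
point over `t`. That set is closed, hence σ-compact, so its projection is a countable union of
compact sets. -/
theorem measurable_iInf_mem_of_lowerSemicontinuous {T X : Type*} [TopologicalSpace T] [T2Space T]
    [SigmaCompactSpace T] [MeasurableSpace T] [BorelSpace T] [TopologicalSpace X]
    [SigmaCompactSpace X] {f : T × X → ℝ≥0} (hf : LowerSemicontinuous f) {F : Set X}
    (hF : IsClosed F) : Measurable fun t => ⨅ ξ ∈ F, (f (t, ξ) : ℝ≥0∞) := by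
  have hproj (q : ℝ≥0) : MeasurableSet (Prod.fst '' (f ⁻¹' Iic q ∩ Prod.snd ⁻¹' F)) := by
    have hcl : IsClosed (f ⁻¹' Iic q ∩ Prod.snd ⁻¹' F) :=
      (hf.isClosed_preimage q).inter (hF.preimage continuous_snd)
    have : f ⁻¹' Iic q ∩ Prod.snd ⁻¹' F =
        ⋃ n, (compactCovering (T × X) n ∩ (f ⁻¹' Iic q ∩ Prod.snd ⁻¹' F)) := by
      rw [← iUnion_inter, iUnion_compactCovering, univ_inter]
    rw [this, image_iUnion]
    exact MeasurableSet.iUnion fun n =>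
      (((isCompact_compactCovering _ n).inter_right hcl).image continuous_fst).measurableSet
  refine measurable_of_Iio fun a => ?_
  have : (fun t => ⨅ ξ ∈ F, (f (t, ξ) : ℝ≥0∞)) ⁻¹' Iio a =
      ⋃ q ∈ {q : ℚ | ((q : ℝ).toNNReal : ℝ≥0∞) < a},
        Prod.fst '' (f ⁻¹' Iic (q : ℝ).toNNReal ∩ Prod.snd ⁻¹' F) := by
    ext t
    simp only [mem_preimage, mem_Iio, iInf_lt_iff, mem_iUnion, mem_image, mem_inter_iff, mem_Iic,
      Prod.exists, exists_and_right, exists_eq_right, exists_prop, mem_ofPred_eq]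
    constructor
    · rintro ⟨ξ, hξ, h⟩
      obtain ⟨q, -, hq, hqa⟩ := ENNReal.lt_iff_exists_rat_btwn.1 h
      exact ⟨q, hqa, ξ, by exact_mod_cast hq.le, hξ⟩
    · rintro ⟨q, hqa, ξ, h, hξ⟩
      exact ⟨ξ, hξ, lt_of_le_of_lt (by exact_mod_cast h) hqa⟩
  rw [this]
  exact MeasurableSet.biUnion (to_countable _) fun q _ => hproj _

/-- Cut `M t` down repeatedly by the first ball of radius `1 / (n + 1)`, from a countable family,
that meets what is left. Compactness leaves exactly one point, and measurability of the hitting sets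
passes through every cut. -/
theorem exists_measurable_selection {T X : Type*} [MeasurableSpace T] [TopologicalSpace X]
    [PolishSpace X] [MeasurableSpace X] [BorelSpace X] {M : T → Set X}
    (hcomp : ∀ t, IsCompact (M t)) (hne : ∀ t, (M t).Nonempty)
    (hmeas : ∀ F, IsClosed F → MeasurableSet {t | (M t ∩ F).Nonempty}) :
    ∃ Φ : T → X, Measurable Φ ∧ ∀ t, Φ t ∈ M t := by
  classical
  rcases isEmpty_or_nonempty T with hT | ⟨⟨t₀⟩⟩
  · exact ⟨fun t => hT.elim t, measurable_of_empty _, fun t => hT.elim t⟩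
  have : Nonempty X := ⟨(hne t₀).some⟩
  let := TopologicalSpace.upgradeIsCompletelyMetrizable X
  let B (n i : ℕ) : Set X := Metric.closedBall (TopologicalSpace.denseSeq X i) (1 / (n + 1))
  have hB n i : IsClosed (B n i) := Metric.isClosed_closedBall
  have hcover (n : ℕ) (A : Set X) (hA : A.Nonempty) : ∃ i, (A ∩ B n i).Nonempty := by
    obtain ⟨x, hx⟩ := hA
    obtain ⟨i, hi⟩ := (TopologicalSpace.denseRange_denseSeq X).exists_dist_lt x
      (ε := 1 / ((n : ℝ) + 1)) (by positivity)
    exact ⟨i, x, hx, hi.le⟩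
  let next (n : ℕ) (A : Set X) : Set X :=
    if h : ∃ i, (A ∩ B n i).Nonempty then A ∩ B n (Nat.find h) else ∅
  let N (n : ℕ) (t : T) : Set X := Nat.rec (M t) next n
  have hN0 t : N 0 t = M t := rfl
  have hNs n t : N (n + 1) t = next n (N n t) := rfl
  have key n : (∀ t, IsCompact (N n t)) ∧ (∀ t, (N n t).Nonempty) ∧
      ∀ F, IsClosed F → MeasurableSet {t | (N n t ∩ F).Nonempty} := by
    induction n with
    | zero => exact ⟨hcomp, hne, hmeas⟩
    | succ n ih =>
      obtain ⟨ic, ine, im⟩ := ih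
      have hex t := hcover n _ (ine t)
      have hstep t : N (n + 1) t = N n t ∩ B n (Nat.find (hex t)) := by
        rw [hNs]; exact dif_pos (hex t)
      refine ⟨fun t => ?_, fun t => ?_, fun F hF => ?_⟩
      · rw [hstep]; exact (ic t).inter_right (hB _ _)
      · rw [hstep]; exact Nat.find_spec (hex t)
      -- Split by the index `i` of the first ball hit; for fixed `i`, hitting `F` after the cut
      -- means hitting the closed set `B n i ∩ F` before it.
      · have : {t | (N (n + 1) t ∩ F).Nonempty} =
            ⋃ i, ({t | (N n t ∩ B n i).Nonempty} ∩
              (⋂ j ∈ Iio i, {t | (N n t ∩ B n j).Nonempty}ᶜ)) ∩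
              {t | (N n t ∩ (B n i ∩ F)).Nonempty} := by
          ext t
          simp only [mem_ofPred_eq, mem_iUnion, mem_inter_iff, mem_iInter, mem_compl_iff, mem_Iio]
          rw [hstep]
          constructor
          · intro h
            exact ⟨Nat.find (hex t), ⟨Nat.find_spec (hex t), fun j hj => Nat.find_min (hex t) hj⟩,
              by rwa [← inter_assoc]⟩
          · rintro ⟨i, ⟨h1, h2⟩, h3⟩
            have : Nat.find (hex t) = i := (Nat.find_eq_iff _).2 ⟨h1, h2⟩
            rwa [this, inter_assoc]
        rw [this]
        exact MeasurableSet.iUnion fun i => ((im _ (hB n i)).inter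
          (MeasurableSet.biInter (to_countable _) fun j _ => (im _ (hB n j)).compl)).inter
          (im _ ((hB n i).inter hF))
  have hanti n t : N (n + 1) t ⊆ N n t := by
    rw [hNs]
    simp only [next]
    split_ifs
    · exact inter_subset_left
    · exact empty_subset _
  have hball n t : ∃ i, N (n + 1) t ⊆ B n i := by
    rw [hNs]
    simp only [next]
    split_ifs with h
    · exact ⟨_, inter_subset_right⟩
    · exact ⟨0, empty_subset _⟩
  have hinter (F : Set X) (hF : IsClosed F) t (h : ∀ n, (N n t ∩ F).Nonempty) :
      (⋂ n, N n t ∩ F).Nonempty :=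
    IsCompact.nonempty_iInter_of_sequence_nonempty_isCompact_isClosed _
      (fun n => inter_subset_inter_left _ (hanti n t)) h (((key 0).1 t).inter_right hF)
      fun n => ((key n).1 t).isClosed.inter hF
  have hpt t : ∃ x, ∀ n, x ∈ N n t := by
    obtain ⟨x, hx⟩ := hinter univ isClosed_univ t fun n => by simpa using (key n).2.1 t
    exact ⟨x, fun n => (mem_iInter.1 hx n).1⟩
  choose Φ hΦ using hpt
  have huniq t x (hx : ∀ n, x ∈ N n t) : x = Φ t := by
    refine eq_of_forall_dist_le fun ε hε => ?_
    obtain ⟨n, hn⟩ := exists_nat_one_div_lt (half_pos hε)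
    obtain ⟨i, hi⟩ := hball n t
    have h1 := Metric.mem_closedBall.1 (hi (hx (n + 1)))
    have h2 := Metric.mem_closedBall.1 (hi (hΦ t (n + 1)))
    have := dist_triangle_right x (Φ t) (TopologicalSpace.denseSeq X i)
    linarith
  refine ⟨Φ, measurable_of_isClosed fun F hF => ?_, fun t => hΦ t 0⟩
  -- If every `N n t` meets `F`, compactness gives a common point in `F`, which can only be `Φ t`.
  have : Φ ⁻¹' F = ⋂ n, {t | (N n t ∩ F).Nonempty} := by
    ext t
    simp only [mem_preimage, mem_iInter, mem_ofPred_eq]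
    refine ⟨fun h n => ⟨Φ t, hΦ t n, h⟩, fun h => ?_⟩
    obtain ⟨x, hx⟩ := hinter F hF t h
    rw [mem_iInter] at hx
    rw [← huniq t x fun n => (hx n).1]
    exact (hx 0).2
  rw [this]
  exact MeasurableSet.iInter fun n => (key n).2.2 F hF

end Selection

/-! ### The pointwise problem -/

section PointObjective

variable {X : Type*} {K : ℕ} {c : X → X → ℝ≥0} {lam : Fin K → ℝ≥0}

theorem pointValue_le (x : Fin K → X) (ξ : X) :
    pointValue c lam x ≤ pointObjective c lam x ξ := iInf_le _ ξ

theorem pointValue_eq {x : Fin K → X} {ξ : X}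
    (h : ∀ η, pointObjective c lam x ξ ≤ pointObjective c lam x η) :
    pointValue c lam x = pointObjective c lam x ξ :=
  le_antisymm (pointValue_le x ξ) (le_iInf fun η => by exact_mod_cast h η)

theorem pointObjective_eq_zero (hlam : ¬ ∃ k, lam k ≠ 0) (x : Fin K → X) (ξ : X) :
    pointObjective c lam x ξ = 0 := by
  push Not at hlam
  simp [pointObjective, hlam]

variable [TopologicalSpace X]

theorem lowerSemicontinuous_pointObjective (hc : LowerSemicontinuous fun z : X × X => c z.1 z.2)
    (lam : Fin K → ℝ≥0) :
    LowerSemicontinuous fun z : X × (Fin K → X) => pointObjective c lam z.2 z.1 := by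
  refine lowerSemicontinuous_sum fun k _ => ?_
  have h : LowerSemicontinuous fun z : X × (Fin K → X) => c z.1 (z.2 k) :=
    hc.comp (g := fun z : X × (Fin K → X) => (z.1, z.2 k)) (by fun_prop)
  exact (continuous_const_mul (lam k)).comp_lowerSemicontinuous h 
    fun a b hab => mul_le_mul_of_nonneg_left hab zero_le

theorem IsTransportCost.isCompact_pointObjective_le [T2Space X] (hc : IsTransportCost c)
    (hlam : ∃ k, lam k ≠ 0) (x : Fin K → X) (r : ℝ≥0) :
    IsCompact {ξ | pointObjective c lam x ξ ≤ r} := by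
  obtain ⟨k, hk⟩ := hlam
  obtain ⟨d, hd, hcomp, p, hp, hpc⟩ := hc.exists_metric
  have hclosed : IsClosed {ξ | pointObjective c lam x ξ ≤ r} :=
    ((lowerSemicontinuous_pointObjective hc.lowerSemicontinuous lam).comp
      (g := fun ξ : X => (ξ, x)) (by fun_prop)).isClosed_preimage r
  -- The objective bound gives `d ^ p ≤ r / lam k`. Either `d ≤ 1` or `d ≤ d ^ p`, and the radius
  -- covers both cases.
  refine (hcomp (x k) (1 + r / lam k)).of_isClosed_subset hclosed fun ξ hξ => ?_
  have h1 : lam k * c ξ (x k) ≤ r :=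
    (Finset.single_le_sum (f := fun k => lam k * c ξ (x k)) (fun _ _ => zero_le)
      (Finset.mem_univ k)).trans hξ
  have h2 : (c ξ (x k) : ℝ) ≤ r / lam k := by
    have : c ξ (x k) ≤ r / lam k := by
      rw [le_div_iff₀ (pos_iff_ne_zero.2 hk), mul_comm]; exact h1
    exact_mod_cast this
  have h3 := hpc ξ (x k)
  change d ξ (x k) ≤ 1 + r / lam k
  rcases le_total (d ξ (x k)) 1 with h | h
  · exact h.trans (le_add_of_nonneg_right (by positivity))
  · have := le_self_pow₀ h (Nat.one_le_iff_ne_zero.1 hp)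
    linarith

theorem IsTransportCost.exists_pointObjective_le [T2Space X] (hc : IsTransportCost c)
    (hlam : ∃ k, lam k ≠ 0) (x : Fin K → X) {F : Set X} (hF : IsClosed F) (hne : F.Nonempty) :
    ∃ ξ ∈ F, ∀ η ∈ F, pointObjective c lam x ξ ≤ pointObjective c lam x η := by
  obtain ⟨ξ₀, hξ₀⟩ := hne
  have hlsc : LowerSemicontinuous (pointObjective c lam x) :=
    (lowerSemicontinuous_pointObjective hc.lowerSemicontinuous lam).comp
      (g := fun ξ : X => (ξ, x)) (by fun_prop)
  obtain ⟨ξ, hξ, hmin⟩ := LowerSemicontinuousOn.exists_isMinOn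
    (s := {ξ | pointObjective c lam x ξ ≤ pointObjective c lam x ξ₀} ∩ F)
    ⟨ξ₀, le_refl (pointObjective c lam x ξ₀), hξ₀⟩
    ((hc.isCompact_pointObjective_le hlam x _).inter_right hF) (hlsc.lowerSemicontinuousOn _)
  refine ⟨ξ, hξ.2, fun η hη => ?_⟩
  rcases le_total (pointObjective c lam x η) (pointObjective c lam x ξ₀) with h | h
  · exact hmin ⟨h, hη⟩
  · exact le_trans hξ.1 h

end PointObjective

/-! ### Measurable selectors and joint laws of barycenter and marginals -/

section Barycenter

variable {X : Type*} [TopologicalSpace X] [PolishSpace X] [MeasurableSpace X] [BorelSpace X]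
  {K : ℕ} {c : X → X → ℝ≥0} {lam : Fin K → ℝ≥0} {P : Fin K → ProbabilityMeasure X}

theorem measurable_pointValue [SigmaCompactSpace X]
    (hc : LowerSemicontinuous fun z : X × X => c z.1 z.2) (lam : Fin K → ℝ≥0) :
    Measurable (pointValue c lam) := by
  have h := measurable_iInf_mem_of_lowerSemicontinuous
    ((lowerSemicontinuous_pointObjective hc lam).comp continuous_swap) isClosed_univ
  change Measurable fun x => ⨅ ξ, (pointObjective c lam x ξ : ℝ≥0∞)
  simpa using h

theorem IsTransportCost.exists_isMeasurableSelector [SigmaCompactSpace X] [Nonempty X]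
    (hc : IsTransportCost c) (lam : Fin K → ℝ≥0) :
    ∃ Φ : (Fin K → X) → X, IsMeasurableSelector c lam Φ := by
  by_cases hlam : ∃ k, lam k ≠ 0
  swap
  -- With all weights zero every point is a minimizer and compactness may fail, but a constant map
  -- works.
  · exact ⟨fun _ => Classical.arbitrary X, measurable_const, fun x ξ => by
      simp [pointObjective_eq_zero hlam]⟩
  have hmin x := hc.exists_pointObjective_le hlam x isClosed_univ univ_nonempty
  obtain ⟨Φ, hΦ, hΦM⟩ := exists_measurable_selection
    (M := fun x => {ξ | ∀ η, pointObjective c lam x ξ ≤ pointObjective c lam x η})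
    (fun x => by
      obtain ⟨ξ, -, hξ⟩ := hmin x
      convert hc.isCompact_pointObjective_le hlam x (pointObjective c lam x ξ) using 1
      ext η
      exact ⟨fun h => h ξ, fun h ζ => le_trans h (hξ ζ (mem_univ ζ))⟩)
    (fun x => by
      obtain ⟨ξ, -, hξ⟩ := hmin x
      exact ⟨ξ, fun η => hξ η (mem_univ η)⟩)
    (fun F hF => by
      rcases F.eq_empty_or_nonempty with rfl | hne
      · simp
      -- Since the minimum over `F` is attained, `F` contains a global minimizer exactly when the
      -- infimum over `F` equals `pointValue`.
      convert measurableSet_eq_fun (measurable_iInf_mem_of_lowerSemicontinuous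
        ((lowerSemicontinuous_pointObjective hc.lowerSemicontinuous lam).comp continuous_swap) hF)
        (measurable_pointValue hc.lowerSemicontinuous lam) using 1
      ext x
      obtain ⟨ξ, hξF, hξ⟩ := hc.exists_pointObjective_le hlam x hF hne
      have hval : ⨅ η ∈ F, (pointObjective c lam x η : ℝ≥0∞) = pointObjective c lam x ξ :=
        le_antisymm (iInf₂_le ξ hξF) (le_iInf₂ fun η hη => by exact_mod_cast hξ η hη)
      simp only [mem_ofPred_eq, Function.comp_apply, Prod.swap_prod_mk, hval]
      constructor
      · rintro ⟨η, hη, hηF⟩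
        rw [pointValue_eq hη]
        exact_mod_cast le_antisymm (hξ η hηF) (hη ξ)
      · intro h
        refine ⟨ξ, fun η => ?_, hξF⟩
        exact_mod_cast h.trans_le (pointValue_le x η))
  exact ⟨Φ, hΦ, hΦM⟩

theorem lintegral_pointObjective (hc : LowerSemicontinuous fun z : X × X => c z.1 z.2)
    (γ : Measure (X × (Fin K → X))) :
    ∫⁻ z, (pointObjective c lam z.2 z.1 : ℝ≥0∞) ∂γ =
      ∑ k, (lam k : ℝ≥0∞) *
        ∫⁻ w, (c w.1 w.2 : ℝ≥0∞) ∂(γ.map fun z : X × (Fin K → X) => (z.1, z.2 k)) := by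
  have hcm : Measurable fun z : X × X => (c z.1 z.2 : ℝ≥0∞) := hc.measurable.coe_nnreal_ennreal
  have hcm' (k : Fin K) : Measurable fun z : X × (Fin K → X) => (c z.1 (z.2 k) : ℝ≥0∞) :=
    hcm.comp (g := fun z : X × X => (c z.1 z.2 : ℝ≥0∞))
      (f := fun z : X × (Fin K → X) => (z.1, z.2 k)) (by fun_prop)
  simp only [pointObjective, ENNReal.ofNNReal_finsetSum, ENNReal.coe_mul]
  rw [lintegral_finsetSum _ fun k _ => (hcm' k).const_mul _]
  refine Finset.sum_congr rfl fun k _ => ?_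
  rw [lintegral_const_mul _ (hcm' k), lintegral_map hcm (by fun_prop)]

theorem barycenterObjective_le_lintegral (hc : LowerSemicontinuous fun z : X × X => c z.1 z.2)
    {Q : ProbabilityMeasure X} (γ : ProbabilityMeasure (X × (Fin K → X)))
    (hfst : (γ : Measure (X × (Fin K → X))).map Prod.fst = (Q : Measure X))
    (hsnd : ∀ k, (γ : Measure (X × (Fin K → X))).map (fun z => z.2 k) = (P k : Measure X)) :
    barycenterObjective c lam P Q ≤
      ∫⁻ z, (pointObjective c lam z.2 z.1 : ℝ≥0∞) ∂(γ : Measure (X × (Fin K → X))) := by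
  rw [lintegral_pointObjective hc]
  refine Finset.sum_le_sum fun k _ => ?_
  gcongr
  have hm : Measurable fun z : X × (Fin K → X) => (z.1, z.2 k) := by fun_prop
  refine iInf₂_le (γ.map hm.aemeasurable) ⟨?_, ?_⟩
  · rw [← hfst]; exact Measure.map_map measurable_fst hm
  · rw [← hsnd k]; exact Measure.map_map measurable_snd hm

theorem exists_lintegral_eq_barycenterObjective
    (hc : LowerSemicontinuous fun z : X × X => c z.1 z.2)
    (lam : Fin K → ℝ≥0) (P : Fin K → ProbabilityMeasure X) (Q : ProbabilityMeasure X) :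
    ∃ γ : ProbabilityMeasure (X × (Fin K → X)),
      (γ : Measure (X × (Fin K → X))).map Prod.fst = (Q : Measure X) ∧
      (∀ k, (γ : Measure (X × (Fin K → X))).map (fun z => z.2 k) = (P k : Measure X)) ∧
      ∫⁻ z, (pointObjective c lam z.2 z.1 : ℝ≥0∞) ∂(γ : Measure (X × (Fin K → X))) =
        barycenterObjective c lam P Q := by
  choose π hπ hπc using fun k => exists_otCost_eq_lintegral hc Q (P k)
  obtain ⟨γ, hγ, hγπ⟩ := exists_gluing Q π fun k => (hπ k).1
  refine ⟨γ, hγ, fun k => ?_, ?_⟩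
  · rw [← (hπ k).2, ← hγπ k, Measure.map_map measurable_snd (by fun_prop)]
    rfl
  · rw [lintegral_pointObjective hc]
    exact Finset.sum_congr rfl fun k _ => by rw [hγπ, hπc]

/-- Minimizing over the joint law of the barycenter and the given marginals; unlike `pointValue`,
the integrand is lower semicontinuous here. -/
theorem IsTransportCost.exists_lintegral_pointObjective_le (hc : IsTransportCost c)
    (hlam : ∃ k, lam k ≠ 0) {ξ₀ : X}
    (hξ₀ : ∀ k, ∫⁻ ξ, (c ξ₀ ξ : ℝ≥0∞) ∂(P k : Measure X) < ∞) :
    ∃ γ : ProbabilityMeasure (X × (Fin K → X)),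
      (∀ k, (γ : Measure (X × (Fin K → X))).map (fun z => z.2 k) = (P k : Measure X)) ∧
      ∀ γ' : ProbabilityMeasure (X × (Fin K → X)),
        (∀ k, (γ' : Measure (X × (Fin K → X))).map (fun z => z.2 k) = (P k : Measure X)) →
        ∫⁻ z, (pointObjective c lam z.2 z.1 : ℝ≥0∞) ∂(γ : Measure (X × (Fin K → X))) ≤
          ∫⁻ z, (pointObjective c lam z.2 z.1 : ℝ≥0∞) ∂(γ' : Measure (X × (Fin K → X))) := by
  obtain ⟨k, hk⟩ := hlam
  obtain ⟨d, hd, hcomp, p, hp, hpc⟩ := hc.exists_metric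
  have hlsc := lowerSemicontinuous_pointObjective hc.lowerSemicontinuous lam
  have hcm : Measurable fun z : X × X => c z.1 z.2 := hc.lowerSemicontinuous.measurable
  let Δ : ProbabilityMeasure X := ⟨Measure.dirac ξ₀, inferInstance⟩
  let J : ProbabilityMeasure (Fin K → X) :=
    ⟨Measure.pi fun k => (P k : Measure X), inferInstance⟩
  -- A competitor of finite cost `v`; only laws of cost at most `v` need be considered, and these
  -- form a tight set.
  let γ₀ : ProbabilityMeasure (X × (Fin K → X)) := Δ.prod J
  have hγ₀ j : (γ₀ : Measure (X × (Fin K → X))).map (fun z => z.2 j) = (P j : Measure X) := by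
    have h2 : (γ₀ : Measure (X × (Fin K → X))).map Prod.snd =
        Measure.pi fun k => (P k : Measure X) :=
      Measure.snd_prod (μ := Measure.dirac ξ₀)
    rw [← (measurePreserving_eval (fun k => (P k : Measure X)) j).map_eq, ← h2,
      Measure.map_map (measurable_pi_apply j) measurable_snd]
    rfl
  set v := ∫⁻ z, (pointObjective c lam z.2 z.1 : ℝ≥0∞) ∂(γ₀ : Measure (X × (Fin K → X))) with hv
  have hv_top : v < ∞ := by
    rw [hv, lintegral_pointObjective hc.lowerSemicontinuous]
    refine ENNReal.sum_lt_top.2 fun j _ => ENNReal.mul_lt_top ENNReal.coe_lt_top ?_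
    have : (γ₀ : Measure (X × (Fin K → X))).map (fun z => (z.1, z.2 j)) =
        (Measure.dirac ξ₀).prod (P j : Measure X) := by
      rw [← (measurePreserving_eval (fun k => (P k : Measure X)) j).map_eq]
      have := Measure.map_prod_map (Measure.dirac ξ₀) (Measure.pi fun k => (P k : Measure X))
        measurable_id (measurable_pi_apply j)
      rw [Measure.map_id] at this
      exact this.symm
    rw [this, Measure.dirac_prod, lintegral_map (by fun_prop) (by fun_prop)]
    exact hξ₀ j
  let S : Set (ProbabilityMeasure (X × (Fin K → X))) :=
    {γ | (∀ k, (γ : Measure (X × (Fin K → X))).map (fun z => z.2 k) = (P k : Measure X)) ∧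
      ∫⁻ z, (pointObjective c lam z.2 z.1 : ℝ≥0∞) ∂(γ : Measure (X × (Fin K → X))) ≤ v}
  have hclosed : IsClosed S := by
    have h1 : IsClosed {γ : ProbabilityMeasure (X × (Fin K → X)) |
        ∀ k, (γ : Measure (X × (Fin K → X))).map (fun z => z.2 k) = (P k : Measure X)} := by
      simp only [ofPred_forall]
      exact isClosed_iInter fun k => isClosed_setOf_map_eq (by fun_prop) (P k)
    exact h1.inter ((lowerSemicontinuous_lintegral hlsc).isClosed_preimage v)
  have htight : IsTightMeasureSet {((μ : ProbabilityMeasure (X × (Fin K → X))) :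
      Measure (X × (Fin K → X))) | μ ∈ S} := by
    apply IsTightMeasureSet.prodMk
    · rw [isTightMeasureSet_iff_exists_isCompact_measure_compl_le]
      intro ε hε
      -- `A` bounds the mean of `c ξ (ξ_k) + c ξ₀ (ξ_k)` under every law in `S`, so Markov's
      -- inequality bounds the tail at `R` by `A / R`.
      let A : ℝ≥0∞ := v / lam k + ∫⁻ ξ, (c ξ₀ ξ : ℝ≥0∞) ∂(P k : Measure X)
      have hA : A < ∞ := ENNReal.add_lt_top.2
        ⟨ENNReal.div_lt_top hv_top.ne (by simpa using hk), hξ₀ k⟩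
      obtain ⟨R, hR1, hRε⟩ : ∃ R : ℝ≥0, 1 ≤ R ∧ A / R ≤ ε := by
        rcases eq_or_ne ε ∞ with rfl | hεt
        · exact ⟨1, le_rfl, le_top⟩
        · refine ⟨1 + (A / ε).toNNReal, le_self_add, ?_⟩
          refine ENNReal.div_le_of_le_mul' ?_
          rw [ENNReal.coe_add, ENNReal.coe_toNNReal (ENNReal.div_lt_top hA.ne hε.ne').ne, add_mul,
            ENNReal.div_mul_cancel hε.ne' hεt]
          exact le_add_self
      -- If `d ξ ξ₀ > 2R`, one leg of the triangle through `ξ_k` exceeds `R`. As `R ≥ 1`, the cost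
      -- of that leg is at least `d ^ p ≥ d > R`.
      refine ⟨_, hcomp ξ₀ (R + R), ?_⟩
      rintro _ ⟨_, ⟨γ, ⟨hγ, hγv⟩, rfl⟩, rfl⟩
      have hmeas := (hcomp ξ₀ (R + R)).isClosed.measurableSet.compl
      have hcR (x y : X) (h : (R : ℝ) < d x y) : (R : ℝ≥0∞) ≤ c x y := by
        have h1 : (1 : ℝ) ≤ R := by exact_mod_cast hR1
        have h2 := le_self_pow₀ (h1.trans h.le) (Nat.one_le_iff_ne_zero.1 hp)
        have h3 : (R : ℝ) ≤ c x y := by linarith [hpc x y]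
        exact_mod_cast h3
      have hRpos : (R : ℝ≥0∞) ≠ 0 := by
        have := zero_lt_one.trans_le hR1
        exact_mod_cast this.ne'
      have hc1 : Measurable fun z : X × (Fin K → X) => (c z.1 (z.2 k) : ℝ≥0∞) :=
        (hcm.comp (g := fun z : X × X => c z.1 z.2)
          (f := fun z : X × (Fin K → X) => (z.1, z.2 k)) (by fun_prop)).coe_nnreal_ennreal
      have hc0 : Measurable fun ξ : X => (c ξ₀ ξ : ℝ≥0∞) := by fun_prop
      have hc2 : Measurable fun z : X × (Fin K → X) => (c ξ₀ (z.2 k) : ℝ≥0∞) :=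
        hc0.comp (by fun_prop : Measurable fun z : X × (Fin K → X) => z.2 k)
      have b1 : ∫⁻ z, (c z.1 (z.2 k) : ℝ≥0∞) ∂(γ : Measure (X × (Fin K → X))) ≤ v / lam k := by
        rw [ENNReal.le_div_iff_mul_le (by simp [hk]) (by simp), mul_comm,
          ← lintegral_const_mul _ hc1]
        refine (lintegral_mono fun z => ?_).trans hγv
        rw [← ENNReal.coe_mul, ENNReal.coe_le_coe]
        exact Finset.single_le_sum (f := fun k => lam k * c z.1 (z.2 k)) (fun _ _ => zero_le)
          (Finset.mem_univ k)
      have b2 : ∫⁻ z, (c ξ₀ (z.2 k) : ℝ≥0∞) ∂(γ : Measure (X × (Fin K → X))) =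
          ∫⁻ ξ, (c ξ₀ ξ : ℝ≥0∞) ∂(P k : Measure X) := by
        rw [← hγ k, lintegral_map hc0 (by fun_prop)]
      rw [Measure.fst_apply hmeas]
      calc (γ : Measure (X × (Fin K → X))) (Prod.fst ⁻¹' {x | d x ξ₀ ≤ R + R}ᶜ)
          ≤ (γ : Measure (X × (Fin K → X)))
              {z | (R : ℝ≥0∞) ≤ c z.1 (z.2 k) + c ξ₀ (z.2 k)} := by
            refine measure_mono fun z hz => ?_
            have hz : (R : ℝ) + R < d z.1 ξ₀ := by simpa using hz
            have htri := hd.triangle z.1 (z.2 k) ξ₀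
            rw [hd.symm (z.2 k) ξ₀] at htri
            change (R : ℝ≥0∞) ≤ c z.1 (z.2 k) + c ξ₀ (z.2 k)
            rcases lt_or_ge (R : ℝ) (d z.1 (z.2 k)) with h | h
            · exact (hcR _ _ h).trans le_self_add
            · exact (hcR _ _ (by linarith)).trans le_add_self
        _ ≤ (∫⁻ z, ((c z.1 (z.2 k) : ℝ≥0∞) + c ξ₀ (z.2 k))
              ∂(γ : Measure (X × (Fin K → X)))) / R :=
            meas_ge_le_lintegral_div (hc1.add hc2).aemeasurable hRpos ENNReal.coe_ne_top
        _ ≤ A / R := by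
            rw [lintegral_add_left hc1, b2]
            gcongr
            exact add_le_add_left b1 _
        _ ≤ ε := hRε
    · apply isTightMeasureSet_pi
      intro j
      refine (isTightMeasureSet_singleton (μ := (P j : Measure X))).subset ?_
      rintro _ ⟨_, ⟨_, ⟨γ, hγ, rfl⟩, rfl⟩, rfl⟩
      rw [mem_singleton_iff, ← hγ.1 j, Measure.snd,
        Measure.map_map (measurable_pi_apply j) measurable_snd]
      rfl
  obtain ⟨γ, hγ, hmin⟩ :=
    exists_lintegral_le_of_isTightMeasureSet hlsc hclosed ⟨γ₀, hγ₀, le_rfl⟩ htight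
  refine ⟨γ, hγ.1, fun γ' hγ' => ?_⟩
  rcases le_total (∫⁻ z, (pointObjective c lam z.2 z.1 : ℝ≥0∞)
    ∂(γ' : Measure (X × (Fin K → X)))) v with h | h
  · exact hmin γ' ⟨hγ', h⟩
  · exact hγ.2.trans h

end Barycenter

/-! ### Equivalence of the multi-margin and barycenter problems -/

section MultiMargin

variable {X : Type*} [MeasurableSpace X] {K : ℕ} {c : X → X → ℝ≥0} {lam : Fin K → ℝ≥0}
  {P : Fin K → ProbabilityMeasure X}

theorem map_snd_mem_multiMarginPlans {γ : ProbabilityMeasure (X × (Fin K → X))}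
    (hγ : ∀ k, (γ : Measure (X × (Fin K → X))).map (fun z => z.2 k) = (P k : Measure X)) :
    γ.map measurable_snd.aemeasurable ∈ multiMarginPlans P := fun k => by
  rw [← hγ k]
  exact Measure.map_map (measurable_pi_apply k) measurable_snd

variable [TopologicalSpace X] [PolishSpace X] [BorelSpace X]

/-- The law of `(Φ x, x)` under `π` is a competitor that couples `Φ_# π` with all the `P k` at once,
and its cost is `∫ φ dπ`. -/
theorem barycenterObjective_map_le_lintegral_pointValue
    (hc : LowerSemicontinuous fun z : X × X => c z.1 z.2) {Φ : (Fin K → X) → X}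
    (hΦ : IsMeasurableSelector c lam Φ) {π : ProbabilityMeasure (Fin K → X)}
    (hπ : π ∈ multiMarginPlans P) :
    barycenterObjective c lam P (π.map hΦ.1.aemeasurable) ≤
      ∫⁻ x, pointValue c lam x ∂(π : Measure (Fin K → X)) := by
  have hm : Measurable fun x : Fin K → X => (Φ x, x) := hΦ.1.prodMk measurable_id
  have hf : Measurable fun z : X × (Fin K → X) => (pointObjective c lam z.2 z.1 : ℝ≥0∞) :=
    (lowerSemicontinuous_pointObjective hc lam).measurable.coe_nnreal_ennreal
  calc barycenterObjective c lam P (π.map hΦ.1.aemeasurable)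
      ≤ ∫⁻ z : X × (Fin K → X), (pointObjective c lam z.2 z.1 : ℝ≥0∞)
          ∂((π.map hm.aemeasurable : ProbabilityMeasure (X × (Fin K → X))) : Measure _) := by
        refine barycenterObjective_le_lintegral hc _ ?_ fun k => ?_
        · exact Measure.map_map measurable_fst hm
        · rw [← hπ k]
          exact Measure.map_map (by fun_prop) hm
    _ = ∫⁻ x, (pointObjective c lam x (Φ x) : ℝ≥0∞) ∂(π : Measure (Fin K → X)) :=
        lintegral_map hf hm
    _ = ∫⁻ x, pointValue c lam x ∂(π : Measure (Fin K → X)) :=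
        lintegral_congr fun x => (pointValue_eq (hΦ.2 x)).symm

theorem lintegral_pointValue_map_snd_le [SigmaCompactSpace X]
    (hc : LowerSemicontinuous fun z : X × X => c z.1 z.2)
    (γ : ProbabilityMeasure (X × (Fin K → X))) :
    ∫⁻ x, pointValue c lam x
        ∂((γ.map measurable_snd.aemeasurable : ProbabilityMeasure (Fin K → X)) : Measure _) ≤
      ∫⁻ z, (pointObjective c lam z.2 z.1 : ℝ≥0∞) ∂(γ : Measure (X × (Fin K → X))) :=
  (lintegral_map (measurable_pointValue hc lam) measurable_snd).trans_le
    (lintegral_mono fun z => pointValue_le z.2 z.1)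

theorem IsTransportCost.exists_isOptimalMultiMarginPlan [SigmaCompactSpace X]
    (hc : IsTransportCost c) (lam : Fin K → ℝ≥0) {ξ₀ : X}
    (hξ₀ : ∀ k, ∫⁻ ξ, (c ξ₀ ξ : ℝ≥0∞) ∂(P k : Measure X) < ∞) :
    ∃ π : ProbabilityMeasure (Fin K → X), IsOptimalMultiMarginPlan c lam P π := by
  have : Nonempty X := ⟨ξ₀⟩
  by_cases hlam : ∃ k, lam k ≠ 0
  · obtain ⟨Φ, hΦ⟩ := hc.exists_isMeasurableSelector lam
    obtain ⟨γ, hγ, hmin⟩ := hc.exists_lintegral_pointObjective_le hlam hξ₀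
    -- The optimal plan is the second marginal of the optimal joint law; any rival `π'` is lifted to
    -- the law of `(Φ x, x)`.
    refine ⟨_, map_snd_mem_multiMarginPlans hγ, fun π' hπ' => ?_⟩
    have hm : Measurable fun x : Fin K → X => (Φ x, x) := hΦ.1.prodMk measurable_id
    have hf : Measurable fun z : X × (Fin K → X) => (pointObjective c lam z.2 z.1 : ℝ≥0∞) :=
      (lowerSemicontinuous_pointObjective
        hc.lowerSemicontinuous lam).measurable.coe_nnreal_ennreal
    refine (lintegral_pointValue_map_snd_le hc.lowerSemicontinuous γ).trans
      ((hmin (π'.map hm.aemeasurable) fun k => ?_).trans_eq ?_)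
    · rw [← hπ' k]
      exact Measure.map_map (by fun_prop) hm
    · exact (lintegral_map hf hm).trans
        (lintegral_congr fun x => (pointValue_eq (hΦ.2 x)).symm)
  · refine ⟨⟨Measure.pi fun k => (P k : Measure X), inferInstance⟩,
      fun k => (measurePreserving_eval (fun k => (P k : Measure X)) k).map_eq, fun π' _ => ?_⟩
    have h0 (x : Fin K → X) : pointValue c lam x = 0 := by
      simp [pointValue, pointObjective_eq_zero hlam]
    simp [h0]

theorem IsOptimalMultiMarginPlan.isOTBarycenter_map [SigmaCompactSpace X]
    (hc : LowerSemicontinuous fun z : X × X => c z.1 z.2) {Φ : (Fin K → X) → X}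
    (hΦ : IsMeasurableSelector c lam Φ) {π : ProbabilityMeasure (Fin K → X)}
    (hπ : IsOptimalMultiMarginPlan c lam P π) :
    IsOTBarycenter c lam P (π.map hΦ.1.aemeasurable) := fun Q => by
  obtain ⟨γ, -, hγ, hγc⟩ := exists_lintegral_eq_barycenterObjective hc lam P Q
  rw [← hγc]
  exact (barycenterObjective_map_le_lintegral_pointValue hc hΦ hπ.1).trans
    ((hπ.2 _ (map_snd_mem_multiMarginPlans hγ)).trans (lintegral_pointValue_map_snd_le hc γ))

theorem barycenterObjective_dirac_lt_top (hc : LowerSemicontinuous fun z : X × X => c z.1 z.2)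
    (lam : Fin K → ℝ≥0) {ξ₀ : X}
    (hξ₀ : ∀ k, ∫⁻ ξ, (c ξ₀ ξ : ℝ≥0∞) ∂(P k : Measure X) < ∞) :
    barycenterObjective c lam P ⟨Measure.dirac ξ₀, inferInstance⟩ < ∞ := by
  have hcm : Measurable fun z : X × X => (c z.1 z.2 : ℝ≥0∞) := hc.measurable.coe_nnreal_ennreal
  refine ENNReal.sum_lt_top.2 fun k _ => ENNReal.mul_lt_top ENNReal.coe_lt_top ?_
  let Δ : ProbabilityMeasure X := ⟨Measure.dirac ξ₀, inferInstance⟩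
  refine (iInf₂_le (Δ.prod (P k)) 
    ⟨Measure.fst_prod (μ := Measure.dirac ξ₀), Measure.snd_prod (μ := Measure.dirac ξ₀)⟩).trans_lt ?_
  change ∫⁻ z, (c z.1 z.2 : ℝ≥0∞) ∂((Measure.dirac ξ₀).prod (P k : Measure X)) < ∞
  rw [Measure.dirac_prod, lintegral_map hcm (by fun_prop)]
  exact hξ₀ k

/-- Redefining `Φ` at the single point `x` to be `ξ` gives another measurable selector. -/
theorem eq_of_unique_isMeasurableSelector {Φ : (Fin K → X) → X}
    (hΦ : IsMeasurableSelector c lam Φ)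
    (huniq : ∀ Φ' : (Fin K → X) → X, IsMeasurableSelector c lam Φ' → Φ' = Φ)
    {x : Fin K → X} {ξ : X}
    (hξ : ∀ η, pointObjective c lam x ξ ≤ pointObjective c lam x η) : ξ = Φ x := by
  classical
  have h := huniq (Function.update Φ x ξ) ⟨?_, fun y η => ?_⟩
  · simpa using congrFun h x
  · have : Function.update Φ x ξ = fun y => if y ∈ ({x} : Set (Fin K → X)) then ξ else Φ y := by
      ext1 y
      simp [Function.update_apply]
    rw [this]
    exact Measurable.ite (measurableSet_singleton x) measurable_const hΦ.1
  · rcases eq_or_ne y x with rfl | hy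
    · simpa using hξ η
    · simpa [hy] using hΦ.2 y η

theorem IsOTBarycenter.exists_isOptimalMultiMarginPlan [SigmaCompactSpace X]
    (hc : LowerSemicontinuous fun z : X × X => c z.1 z.2) {ξ₀ : X}
    (hξ₀ : ∀ k, ∫⁻ ξ, (c ξ₀ ξ : ℝ≥0∞) ∂(P k : Measure X) < ∞) {Φ : (Fin K → X) → X}
    (hΦ : IsMeasurableSelector c lam Φ)
    (huniq : ∀ Φ' : (Fin K → X) → X, IsMeasurableSelector c lam Φ' → Φ' = Φ)
    {Q : ProbabilityMeasure X} (hQ : IsOTBarycenter c lam P Q) :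
    ∃ π : ProbabilityMeasure (Fin K → X),
      IsOptimalMultiMarginPlan c lam P π ∧ Q = π.map hΦ.1.aemeasurable := by
  obtain ⟨γ, hγQ, hγ, hγc⟩ := exists_lintegral_eq_barycenterObjective hc lam P Q
  have hle {π : ProbabilityMeasure (Fin K → X)} (hπ : π ∈ multiMarginPlans P) :
      ∫⁻ z, (pointObjective c lam z.2 z.1 : ℝ≥0∞) ∂(γ : Measure (X × (Fin K → X))) ≤
        ∫⁻ x, pointValue c lam x ∂(π : Measure (Fin K → X)) :=
    hγc.trans_le ((hQ _).trans (barycenterObjective_map_le_lintegral_pointValue hc hΦ hπ))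
  have hmem := map_snd_mem_multiMarginPlans hγ
  refine ⟨_, ⟨hmem, fun π' hπ' => (lintegral_pointValue_map_snd_le hc γ).trans (hle hπ')⟩, ?_⟩
  have hf : Measurable fun z : X × (Fin K → X) => (pointObjective c lam z.2 z.1 : ℝ≥0∞) :=
    (lowerSemicontinuous_pointObjective hc lam).measurable.coe_nnreal_ennreal
  have hval : ∫⁻ z, pointValue c lam z.2 ∂(γ : Measure (X × (Fin K → X))) =
      ∫⁻ x, pointValue c lam x
        ∂((γ.map measurable_snd.aemeasurable : ProbabilityMeasure (Fin K → X)) : Measure _) :=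
    (lintegral_map (measurable_pointValue hc lam) measurable_snd).symm
  have hfin : ∫⁻ z, pointValue c lam z.2 ∂(γ : Measure (X × (Fin K → X))) ≠ ∞ := by
    rw [hval]
    exact ((lintegral_pointValue_map_snd_le hc γ).trans_lt
      (hγc.trans_lt ((hQ _).trans_lt (barycenterObjective_dirac_lt_top hc lam hξ₀)))).ne
  -- Optimality makes the integrals of `pointValue` and of the larger `pointObjective` equal;
  -- finiteness turns this into equality almost everywhere.
  have hae : (fun z : X × (Fin K → X) => pointValue c lam z.2)
      =ᵐ[(γ : Measure (X × (Fin K → X)))] fun z => (pointObjective c lam z.2 z.1 : ℝ≥0∞) :=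
    ae_eq_of_ae_le_of_lintegral_le (Eventually.of_forall fun z => pointValue_le z.2 z.1) hfin
      hf.aemeasurable (hval ▸ hle hmem)
  have hΦae : Prod.fst =ᵐ[(γ : Measure (X × (Fin K → X)))] fun z => Φ z.2 := by
    filter_upwards [hae] with z hz
    refine eq_of_unique_isMeasurableSelector hΦ huniq fun η => ?_
    exact_mod_cast hz.symm.trans_le (pointValue_le z.2 η)
  apply Subtype.ext
  exact hγQ.symm.trans
    ((Measure.map_congr hΦae).trans (Measure.map_map hΦ.1 measurable_snd).symm)

end MultiMargin

theorem theorem1 {d K : ℕ} (Ξ : Set (EuclideanSpace ℝ (Fin d)))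
    (hΞ_closed : IsClosed Ξ) (hΞ_convex : Convex ℝ Ξ)
    (c : Ξ → Ξ → ℝ≥0) (hc : IsTransportCost c)
    (lam : Fin K → ℝ≥0) (P : Fin K → ProbabilityMeasure Ξ)
    (hP : ∃ ξ₀ : Ξ, ∀ k, ∫⁻ ξ, (c ξ₀ ξ : ℝ≥0∞) ∂(P k : Measure Ξ) < ∞) :
    -- the optimal value function and a measurable selector are well defined
    Measurable (pointValue (K := K) c lam) ∧
    (∃ Φ : (Fin K → Ξ) → Ξ, IsMeasurableSelector c lam Φ) ∧
    -- the multi-margin problem is solvable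
    (∃ π : ProbabilityMeasure (Fin K → Ξ), IsOptimalMultiMarginPlan c lam P π) ∧
    ∀ (Φ : (Fin K → Ξ) → Ξ) (hΦ : IsMeasurableSelector c lam Φ),
      -- every optimal plan is pushed forward to an OT barycenter
      (∀ π : ProbabilityMeasure (Fin K → Ξ), IsOptimalMultiMarginPlan c lam P π →
        IsOTBarycenter c lam P (π.map hΦ.1.aemeasurable)) ∧
      -- if the measurable selector is unique, every OT barycenter has this form
      ((∀ Φ' : (Fin K → Ξ) → Ξ, IsMeasurableSelector c lam Φ' → Φ' = Φ) →
        ∀ Q : ProbabilityMeasure Ξ, IsOTBarycenter c lam P Q →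
          ∃ π : ProbabilityMeasure (Fin K → Ξ),
            IsOptimalMultiMarginPlan c lam P π ∧ Q = π.map hΦ.1.aemeasurable) := by
  -- Closedness supplies both Polishness, for Prokhorov's theorem and disintegration, and
  -- σ-compactness, for measurable projections.
  have : PolishSpace Ξ := hΞ_closed.polishSpace
  have : SigmaCompactSpace Ξ := hΞ_closed.isClosedEmbedding_subtypeVal.sigmaCompactSpace
  obtain ⟨ξ₀, hξ₀⟩ := hP
  have : Nonempty Ξ := ⟨ξ₀⟩
  have hlsc := hc.lowerSemicontinuous
  exact ⟨measurable_pointValue hlsc lam, hc.exists_isMeasurableSelector lam,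
    hc.exists_isOptimalMultiMarginPlan lam hξ₀, fun Φ hΦ =>
      ⟨fun π hπ => hπ.isOTBarycenter_map hlsc hΦ,
        fun huniq Q hQ => hQ.exists_isOptimalMultiMarginPlan hlsc hξ₀ hΦ huniq⟩⟩
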